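/- Let $K=\mathbb F_q$ be a finite field and let $V=\bigoplus_{\mathbb N}K$ be the discrete vector space of countably infinite dimension. Let $\mathrm{Sub}(V)$ be the space of all linear subspaces of $V$ with the Chabauty topology, that is, the topology of pointwise convergence of indicator functions, and its Borel $\sigma$-algebra. An invariant random subspace is a Borel probability measure on $\mathrm{Sub}(V)$ that is invariant under all linear automorphisms of $V$. It is indecomposable if it cannot be written as $t\mu_1+(1-t)\mu_2$ with $t\in(0,1)$ and $\mu_1\neq\mu_2$ invariant random subspaces. Let $\lambda$ be an indecomposable invariant random subspace of $V$ with $\lambda\neq\delta_{\{0\}}$, the point mass at the zero subspace. Then there is a unique integer $\kappa\ge 0$ such that $\lambda$ is the law of the random subspace $\ker h$, where $h$ is distributed according to the normalized Haar measure on the compact group $\mathrm{Hom}_{K}(V,K^\kappa)$ (with the topology of pointwise convergence). -/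

import Mathlib

open MeasureTheory

namespace RandomSubspace

variable (K : Type*) [Field K]

/-- The countably infinite direct sum of copies of `K`, regarded as a discrete vector space. -/
abbrev DirSum : Type _ := ℕ →₀ K

/-- The space of (closed) subspaces of the discrete vector space `⨁_ℕ K`. As the space is
discrete, every subspace is closed and every linear automorphism is a homeomorphism. -/
abbrev Sub : Type _ := Submodule K (DirSum K)

open Classical in
/-- The Chabauty topology on the subspaces of a discrete space: `S` is identified with its
indicator function, a point of the product space `{0,1}^V` (pointwise convergence). -/
noncomputable instance instTopologicalSpaceSub : TopologicalSpace (Sub K) :=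
  TopologicalSpace.induced (fun (S : Sub K) (v : DirSum K) => decide (v ∈ S)) inferInstance

noncomputable instance instMeasurableSpaceSub : MeasurableSpace (Sub K) := borel _

instance instBorelSpaceSub : BorelSpace (Sub K) := ⟨rfl⟩

/-- `Hom_K(⨁_ℕ K, K^κ)`. -/
abbrev HomTo (κ : ℕ) : Type _ := DirSum K →ₗ[K] (Fin κ → K)

/-- The compact-open topology on `Hom_K(⨁_ℕ K, K^κ)`. As the source and the target are
discrete, this is the topology of pointwise convergence. -/
noncomputable instance instTopologicalSpaceHomTo (κ : ℕ) : TopologicalSpace (HomTo K κ) :=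
  TopologicalSpace.induced (fun (h : HomTo K κ) (v : DirSum K) => h v)
    (Pi.topologicalSpace (t₂ := fun _ => ⊥))

noncomputable instance instMeasurableSpaceHomTo (κ : ℕ) : MeasurableSpace (HomTo K κ) := borel _

instance instBorelSpaceHomTo (κ : ℕ) : BorelSpace (HomTo K κ) := ⟨rfl⟩

instance instIsTopologicalAddGroupHomTo (κ : ℕ) : IsTopologicalAddGroup (HomTo K κ) := by
  let _ : TopologicalSpace (Fin κ → K) := ⊥
  have : DiscreteTopology (Fin κ → K) := ⟨rfl⟩
  exact topologicalAddGroup_induced (LinearMap.ltoFun K (DirSum K) (Fin κ → K) K)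

instance instCompactSpaceHomTo [Finite K] (κ : ℕ) : CompactSpace (HomTo K κ) := by
  let _ : TopologicalSpace (Fin κ → K) := ⊥
  have : DiscreteTopology (Fin κ → K) := ⟨rfl⟩
  have hind : Topology.IsInducing (fun (h : HomTo K κ) (v : DirSum K) => h v) := ⟨rfl⟩
  have hinj : Function.Injective (fun (h : HomTo K κ) (v : DirSum K) => h v) :=
    DFunLike.coe_injective
  have hcl : IsClosed (Set.range (fun (h : HomTo K κ) (v : DirSum K) => h v)) := by
    have : Set.range (fun (h : HomTo K κ) (v : DirSum K) => h v) =
        (⋂ (v : DirSum K) (w : DirSum K), {f | f (v + w) = f v + f w}) ∩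
        ⋂ (c : K) (v : DirSum K), {f : DirSum K → Fin κ → K | f (c • v) = c • f v} := by
      ext f
      simp only [Set.mem_range, Set.mem_inter_iff, Set.mem_iInter, Set.mem_ofPred_eq]
      constructor
      · rintro ⟨h, rfl⟩
        exact ⟨fun v w => map_add h v w, fun c v => map_smul h c v⟩
      · rintro ⟨h₁, h₂⟩
        exact ⟨{ toFun := f, map_add' := h₁, map_smul' := h₂ }, rfl⟩
    rw [this]
    refine IsClosed.inter ?_ ?_
    · exact isClosed_iInter fun v => isClosed_iInter fun w =>
        isClosed_eq (continuous_apply _)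
          (Continuous.add (f := fun p : DirSum K → Fin κ → K => p v) (continuous_apply v)
            (continuous_apply w))
    · exact isClosed_iInter fun c => isClosed_iInter fun v =>
        isClosed_eq (continuous_apply _)
          ((continuous_of_discreteTopology (f := fun x : Fin κ → K => c • x)).comp
            (continuous_apply _))
  exact (Topology.IsClosedEmbedding.mk ⟨hind, hinj⟩ hcl).compactSpace

/-- The normalized Haar measure on the compact group `Hom_K(⨁_ℕ K, K^κ)`. -/
noncomputable def haarHom [Finite K] (κ : ℕ) : Measure (HomTo K κ) :=
  Measure.addHaarMeasure ⊤

/-- The law of the random subspace `ker h`, for a Haar-random `h : ⨁_ℕ K → K^κ`. -/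
noncomputable def kerLaw [Finite K] (κ : ℕ) : Measure (Sub K) :=
  (haarHom K κ).map (fun h : HomTo K κ => LinearMap.ker h)

variable {K}

/-- Borel probability measures on the space of subspaces of `⨁_ℕ K` which are invariant under
all linear automorphisms of `⨁_ℕ K`. -/
def IsCRS (μ : Measure (Sub K)) : Prop :=
  IsProbabilityMeasure μ ∧
    ∀ g : DirSum K ≃ₗ[K] DirSum K, μ.map (fun S : Sub K => S.map g.toLinearMap) = μ

/-- Indecomposable invariant measures: those which are not a nontrivial convex combination of
two distinct invariant probability measures. -/
def IsIndecomposableCRS (μ : Measure (Sub K)) : Prop :=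
  IsCRS μ ∧ ¬ ∃ (μ₁ μ₂ : Measure (Sub K)) (t : ℝ), IsCRS μ₁ ∧ IsCRS μ₂ ∧ μ₁ ≠ μ₂ ∧
    0 < t ∧ t < 1 ∧ μ = ENNReal.ofReal t • μ₁ + ENNReal.ofReal (1 - t) • μ₂

end RandomSubspace

/-! Let `q` be the order of `K` and `V_N` the span of the first `N` basis vectors. The density of
`S` in `V_N` is `q⁻¹` to the codimension of `S ∩ V_N` in `V_N`, and tends to `q^(-codim S)`, read as
`0` in infinite codimension. Having codimension at least `k` is an invariant event, so
indecomposability makes this limit a constant `L` almost surely (`exists_ae_tendsto`).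

Since automorphisms act transitively on independent `n`-tuples, the probability of containing such a
tuple depends only on `n`. Averaged over all `n`-tuples of `V_N`, nearly all of them independent, it
becomes the `n`-th moment of the density, so it equals `L ^ n` (`real_forall_mem_of_tendsto`). These
probabilities determine the law: `L = 0` gives the excluded point mass at `⊥`, and `L = q^(-κ)`
gives the kernel law (`kerLaw_real_forall_mem`). -/

namespace RandomSubspace

open Filter Topology Module

/-! ### Borel structure on the space of subspaces -/

section Measurability

variable {K : Type*} [Field K]

theorem comap_decide_pi_eq {α V : Type*} (P : α → V → Prop) [∀ a v, Decidable (P a v)] :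
    MeasurableSpace.comap (fun a v => decide (P a v)) MeasurableSpace.pi =
      MeasurableSpace.comap P MeasurableSpace.pi := by
  apply le_antisymm
  · let _ : MeasurableSpace α := MeasurableSpace.comap P MeasurableSpace.pi
    rw [← measurable_iff_comap_le, measurable_pi_iff]
    intro v
    refine measurable_to_bool ?_
    have : (fun a => decide (P a v)) ⁻¹' {true} = P ⁻¹' {p | p v} := by
      ext a; simp
    rw [this]
    exact ⟨_, measurableSet_setOfPred.2 (measurable_pi_apply v), rfl⟩
  · let _ : MeasurableSpace α :=
      MeasurableSpace.comap (fun a v => decide (P a v)) MeasurableSpace.pi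
    rw [← measurable_iff_comap_le, measurable_pi_iff]
    intro v
    refine measurableSet_setOfPred.1 ⟨(fun p : V → Bool => p v) ⁻¹' {true}, ?_, ?_⟩
    · exact measurable_pi_apply v (measurableSet_singleton true)
    · ext a; simp

/-- Finiteness of `K` makes the index set `DirSum K` countable, so on `{0,1}^V` the Borel and
product σ-algebras agree. -/
theorem instMeasurableSpaceSub_eq_comap [Finite K] :
    (instMeasurableSpaceSub K) =
      MeasurableSpace.comap (fun (S : Sub K) (v : DirSum K) => v ∈ S) MeasurableSpace.pi := by
  classical
  rw [← comap_decide_pi_eq]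
  change borel (Sub K) = _
  rw [BorelSpace.measurable_eq (α := DirSum K → Bool), ← borel_comap]

theorem comap_mem_pi_le_generateFrom {R V : Type*} [Ring R] [AddCommGroup V] [Module R V] :
    MeasurableSpace.comap (fun (S : Submodule R V) (v : V) => v ∈ S) MeasurableSpace.pi ≤
      MeasurableSpace.generateFrom {A | ∃ W : Submodule R V, W.FG ∧ A = {S | W ≤ S}} := by
  let m := MeasurableSpace.generateFrom {A | ∃ W : Submodule R V, W.FG ∧ A = {S | W ≤ S}}
  rw [← measurable_iff_comap_le, measurable_pi_iff]
  refine fun v => measurableSet_setOfPred.1 (MeasurableSpace.measurableSet_generateFrom ?_)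
  exact ⟨Submodule.span R {v}, Submodule.fg_span_singleton v, by
    ext S; simp [Submodule.span_singleton_le_iff_mem]⟩

theorem exists_linearIndependent_span_eq {V : Type*} [AddCommGroup V] [Module K V]
    {W : Submodule K V} (hW : W.FG) :
    ∃ (n : ℕ) (v : Fin n → V), LinearIndependent K v ∧ Submodule.span K (Set.range v) = W := by
  have : Module.Finite K W := Module.Finite.iff_fg.2 hW
  let b := Module.finBasis K W
  refine ⟨_, fun i => (b i : V), b.linearIndependent.map' W.subtype W.ker_subtype, ?_⟩
  have := congrArg (Submodule.map W.subtype) b.span_eq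
  rwa [Submodule.map_span, ← Set.range_comp, Submodule.map_top, W.range_subtype] at this

variable [Finite K]

theorem measurableSet_setOf_mem (v : DirSum K) : MeasurableSet {S : Sub K | v ∈ S} := by
  rw [instMeasurableSpaceSub_eq_comap]
  exact ⟨{p | p v}, measurableSet_setOfPred.2 (measurable_pi_apply v), rfl⟩

theorem measurable_sub_of_mem {α : Type*} [MeasurableSpace α] {f : α → Sub K}
    (hf : ∀ v, MeasurableSet {a | v ∈ f a}) : Measurable f := by
  rw [measurable_iff_comap_le, instMeasurableSpaceSub_eq_comap, MeasurableSpace.comap_comp,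
    ← measurable_iff_comap_le, measurable_pi_iff]
  exact fun v => measurableSet_setOfPred.1 (hf v)

theorem measurableSet_setOf_forall_mem {ι : Type*} [Countable ι] (v : ι → DirSum K) :
    MeasurableSet {S : Sub K | ∀ i, v i ∈ S} := by
  rw [Set.ofPred_forall]
  exact MeasurableSet.iInter fun i => measurableSet_setOf_mem (v i)

theorem measurable_map_equiv (g : DirSum K ≃ₗ[K] DirSum K) :
    Measurable (fun S : Sub K => S.map g.toLinearMap) := by
  refine measurable_sub_of_mem fun v => ?_
  convert measurableSet_setOf_mem (g.symm v) using 3 with S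
  exact Submodule.mem_map_equiv (e := g) S

/-- A random subspace is determined by the probabilities that it contains given finite linearly
independent families. -/
theorem measure_ext_of_linearIndependent {μ ν : Measure (Sub K)} [IsProbabilityMeasure μ]
    [IsProbabilityMeasure ν]
    (h : ∀ (n : ℕ) (v : Fin n → DirSum K), LinearIndependent K v →
      μ {S | ∀ i, v i ∈ S} = ν {S | ∀ i, v i ∈ S}) : μ = ν := by
  have key : ∀ (n : ℕ) (v : Fin n → DirSum K), LinearIndependent K v →
      {S : Sub K | ∀ i, v i ∈ S} = {S : Sub K | Submodule.span K (Set.range v) ≤ S} := by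
    intro n v _
    ext S
    simp [Submodule.span_le, Set.range_subset_iff]
  -- These events form a π-system: containing `W` and `W'` means containing `W ⊔ W'`.
  refine ext_of_generate_finite {A | ∃ W : Sub K, W.FG ∧ A = {S | W ≤ S}} ?_ ?_ ?_ (by simp)
  · apply le_antisymm
    · exact instMeasurableSpaceSub_eq_comap.trans_le comap_mem_pi_le_generateFrom
    · refine MeasurableSpace.generateFrom_le ?_
      rintro _ ⟨W, -, rfl⟩
      convert measurableSet_setOf_forall_mem (fun w : W => (w : DirSum K)) using 3 with S
      simp [SetLike.le_def]
  · rintro _ ⟨W, hW, rfl⟩ _ ⟨W', hW', rfl⟩ -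
    exact ⟨W ⊔ W', hW.sup hW', by ext S; simp⟩
  · rintro _ ⟨W, hW, rfl⟩
    obtain ⟨n, v, hv, rfl⟩ := exists_linearIndependent_span_eq hW
    have := h n v hv
    rwa [key n v hv] at this

end Measurability

/-! ### Transitivity on independent tuples -/

section Homogeneity

variable {K : Type*} [Field K]

theorem exists_linearEquiv_apply_eq {V : Type*} [AddCommGroup V] [Module K V] {n : ℕ}
    {v w : Fin n → V} (hv : LinearIndependent K v) (hw : LinearIndependent K w) :
    ∃ g : V ≃ₗ[K] V, ∀ i, g (v i) = w i := by
  obtain ⟨C, hC⟩ := Submodule.exists_isCompl (Submodule.span K (Set.range v))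
  obtain ⟨D, hD⟩ := Submodule.exists_isCompl (Submodule.span K (Set.range w))
  let e := (Basis.span hv).equiv (Basis.span hw) (Equiv.refl _)
  have : Module.Finite K (Submodule.span K (Set.range w)) :=
    Module.Finite.span_of_finite K (Set.finite_range w)
  have hr : Module.rank K C = Module.rank K D := by
    have h1 := (Submodule.prodEquivOfIsCompl _ _ hC).rank_eq
    have h2 := (Submodule.prodEquivOfIsCompl _ _ hD).rank_eq
    rw [rank_prod'] at h1 h2
    rw [← h2, e.rank_eq] at h1
    -- Cancelling the rank of the span is legitimate only because it is finite.
    exact Cardinal.eq_of_add_eq_add_left h1 (rank_lt_aleph0 K _)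
  obtain ⟨f⟩ := nonempty_linearEquiv_of_rank_eq hr
  refine ⟨(Submodule.prodEquivOfIsCompl _ _ hC).symm ≪≫ₗ (e.prodCongr f) ≪≫ₗ
    Submodule.prodEquivOfIsCompl _ _ hD, fun i => ?_⟩
  have hi : v i = ((Basis.span hv i : Submodule.span K (Set.range v)) : V) := by
    rw [Basis.span_apply]
  rw [hi, LinearEquiv.trans_apply, LinearEquiv.trans_apply, Submodule.prodEquivOfIsCompl_symm_apply_left]
  have he : e (Basis.span hv i) = Basis.span hw i := by
    rw [Basis.equiv_apply, Equiv.refl_apply]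
  rw [LinearEquiv.prodCongr_apply, he]
  simp [Basis.span_apply]

theorem IsCRS.measure_forall_mem_eq [Finite K] {μ : Measure (Sub K)} (hμ : IsCRS μ) {n : ℕ}
    {v w : Fin n → DirSum K} (hv : LinearIndependent K v) (hw : LinearIndependent K w) :
    μ {S | ∀ i, v i ∈ S} = μ {S | ∀ i, w i ∈ S} := by
  obtain ⟨g, hg⟩ := exists_linearEquiv_apply_eq hv hw
  conv_rhs => rw [← hμ.2 g, Measure.map_apply (measurable_map_equiv g)
    (measurableSet_setOf_forall_mem w)]
  congr 1
  ext S
  refine forall_congr' fun i => ?_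
  rw [← hg i]
  exact (Submodule.mem_map_equiv (e := g) (x := g (v i)) S).trans (by simp) |>.symm

end Homogeneity

/-! ### Moments of the kernel law -/

section KerLaw

variable (K : Type*) [Field K] (κ : ℕ)

theorem measurableSet_setOf_apply_eq (v : DirSum K) (y : Fin κ → K) :
    MeasurableSet {h : HomTo K κ | h v = y} := by
  let _ : TopologicalSpace (Fin κ → K) := ⊥
  have : DiscreteTopology (Fin κ → K) := ⟨rfl⟩
  have hc : Continuous (fun h : HomTo K κ => h v) :=
    (continuous_apply v).comp (continuous_induced_dom (f := fun (h : HomTo K κ) v => h v))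
  exact ((isOpen_discrete {y}).preimage hc).measurableSet

variable [Finite K]

theorem measurable_ker : Measurable (fun h : HomTo K κ => LinearMap.ker h) :=
  measurable_sub_of_mem fun v => measurableSet_setOf_apply_eq K κ v 0

instance isProbabilityMeasure_haarHom : IsProbabilityMeasure (haarHom K κ) :=
  ⟨by simpa [haarHom] using
    Measure.addHaarMeasure_self (K₀ := (⊤ : TopologicalSpace.PositiveCompacts (HomTo K κ)))⟩

instance isProbabilityMeasure_kerLaw : IsProbabilityMeasure (kerLaw K κ) :=
  Measure.isProbabilityMeasure_map (measurable_ker K κ).aemeasurable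

/-- The values of `h` on the tuple can be prescribed freely, so the fibres of `h ↦ (h (v i))` are
translates of one another. Haar measure gives equal mass to these `(q^κ)^n` sets, which partition
the group. -/
theorem kerLaw_real_forall_mem {n : ℕ} {v : Fin n → DirSum K} (hv : LinearIndependent K v) :
    (kerLaw K κ).real {S | ∀ i, v i ∈ S} = (((Nat.card K : ℝ)⁻¹) ^ κ) ^ n := by
  have := Fintype.ofFinite K
  have : Measure.IsAddLeftInvariant (haarHom K κ) := by
    unfold haarHom; infer_instance
  let A : (Fin n → Fin κ → K) → Set (HomTo K κ) := fun y => {h | ∀ i, h (v i) = y i}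
  have hA : ∀ y, MeasurableSet (A y) := fun y => by
    simp only [A, Set.ofPred_forall]
    exact MeasurableSet.iInter fun i => measurableSet_setOf_apply_eq K κ _ _
  have heq : ∀ y, (haarHom K κ).real (A y) = (haarHom K κ).real (A 0) := by
    intro y
    obtain ⟨h, hh⟩ : ∃ h : HomTo K κ, ∀ i, h (v i) = y i := by
      obtain ⟨h, hh⟩ := LinearMap.exists_extend ((Basis.span hv).constr K y)
      refine ⟨h, fun i => ?_⟩
      have := LinearMap.congr_fun hh (Basis.span hv i)
      rw [Basis.constr_basis] at this
      rw [← this]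
      simp [Basis.span_apply]
    have : A 0 = (fun f => h + f) ⁻¹' A y := by
      ext f; simp [A, hh]
    rw [measureReal_def, measureReal_def, this, measure_preimage_add]
  have hsum : ∑ y, (haarHom K κ).real (A y) = 1 := by
    rw [← measureReal_iUnion_fintype ?_ hA, ← probReal_univ (μ := haarHom K κ)]
    · congr 1
      ext h
      simp only [Set.mem_iUnion, Set.mem_univ, iff_true]
      exact ⟨fun i => h (v i), fun i => rfl⟩
    · intro y z hyz
      refine Set.disjoint_left.2 fun h hy hz => hyz (funext fun i => (hy i).symm.trans (hz i))
  simp_rw [heq] at hsum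
  rw [Finset.sum_const, nsmul_eq_mul, Finset.card_univ, Fintype.card_fun, Fintype.card_fun,
    Fintype.card_fin, Fintype.card_fin] at hsum
  have : (kerLaw K κ).real {S | ∀ i, v i ∈ S} = (haarHom K κ).real (A 0) := by
    rw [kerLaw, map_measureReal_apply (measurable_ker K κ) (measurableSet_setOf_forall_mem v)]
    rfl
  rw [this, ← Nat.card_eq_fintype_card] at *
  push_cast at hsum
  rw [inv_pow, inv_pow]
  exact eq_inv_of_mul_eq_one_right hsum

end KerLaw

/-! ### Codimension and its finite truncations -/

section Codimension

variable {K : Type*} [Field K]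

variable (K) in
/-- The inclusion of the span of the first `N` basis vectors. -/
noncomputable def initialInclusion (N : ℕ) : (Fin N → K) →ₗ[K] DirSum K :=
  Finsupp.lmapDomain K K Fin.val ∘ₗ (Finsupp.linearEquivFunOnFinite K K (Fin N)).symm.toLinearMap

theorem initialInclusion_injective (N : ℕ) : Function.Injective (initialInclusion K N) :=
  (Finsupp.mapDomain_injective Fin.val_injective).comp (LinearEquiv.injective _)

theorem exists_initialInclusion_eq (v : DirSum K) :
    ∃ N₀, ∀ N ≥ N₀, ∃ x, initialInclusion K N x = v := by
  refine ⟨v.support.sup id + 1, fun N hN => ?_⟩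
  refine ⟨Finsupp.linearEquivFunOnFinite K K (Fin N)
    (v.comapDomain Fin.val Fin.val_injective.injOn), ?_⟩
  simp only [initialInclusion, LinearMap.comp_apply, LinearEquiv.coe_coe,
    LinearEquiv.symm_apply_apply, Finsupp.lmapDomain_apply]
  refine Finsupp.mapDomain_comapDomain _ Fin.val_injective _ fun i hi => ?_
  have : i ≤ v.support.sup id := Finset.le_sup (f := id) hi
  exact ⟨⟨i, by omega⟩, rfl⟩

/-- The codimension of the trace of `S` in the span of the first `N` basis vectors. -/
noncomputable def initialCodim (N : ℕ) (S : Sub K) : ℕ :=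
  finrank K (LinearMap.range (S.mkQ ∘ₗ initialInclusion K N))

/-- The subspaces of codimension at least `k`. -/
def codimGE (K : Type*) [Field K] (k : ℕ) : Set (Sub K) :=
  {S | ∃ v : Fin k → DirSum K, LinearIndependent K (S.mkQ ∘ v)}

theorem eventually_le_initialCodim {k : ℕ} {S : Sub K} (hS : S ∈ codimGE K k) :
    ∀ᶠ N in atTop, k ≤ initialCodim N S := by
  obtain ⟨v, hv⟩ := hS
  choose N₀ hN₀ using fun i => exists_initialInclusion_eq (v i)
  filter_upwards [eventually_ge_atTop (Finset.univ.sup N₀)] with N hN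
  choose x hx using fun i => hN₀ i N ((Finset.le_sup (Finset.mem_univ i)).trans hN)
  have hs : Submodule.span K (Set.range (S.mkQ ∘ v)) ≤
      LinearMap.range (S.mkQ ∘ₗ initialInclusion K N) := by
    rw [Submodule.span_le]
    rintro _ ⟨i, rfl⟩
    exact ⟨x i, by simp [hx]⟩
  have := Submodule.finrank_mono hs
  rwa [finrank_span_eq_card hv, Fintype.card_fin] at this

theorem mem_codimGE_of_le {k N : ℕ} {S : Sub K} (h : k ≤ initialCodim N S) : S ∈ codimGE K k := by
  obtain ⟨f, hf⟩ := exists_linearIndependent_of_le_finrank h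
  choose x hx using fun i => (f i).2
  refine ⟨fun i => initialInclusion K N (x i), ?_⟩
  have := hf.map' (Submodule.subtype _) (Submodule.ker_subtype _)
  have heq : S.mkQ ∘ (fun i => initialInclusion K N (x i)) = Submodule.subtype _ ∘ f :=
    funext hx
  rwa [heq]

theorem codimGE_zero : codimGE K 0 = Set.univ :=
  Set.eq_univ_of_forall fun _ => ⟨0, linearIndependent_empty_type⟩

theorem map_mem_codimGE {k : ℕ} (g : DirSum K ≃ₗ[K] DirSum K) {S : Sub K} (hS : S ∈ codimGE K k) :
    S.map g.toLinearMap ∈ codimGE K k := by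
  obtain ⟨v, hv⟩ := hS
  refine ⟨g ∘ v, ?_⟩
  exact hv.map' (Submodule.Quotient.equiv S _ g rfl).toLinearMap (LinearEquiv.ker _)

theorem preimage_map_codimGE (k : ℕ) (g : DirSum K ≃ₗ[K] DirSum K) :
    (fun S : Sub K => S.map g.toLinearMap) ⁻¹' codimGE K k = codimGE K k := by
  refine Set.Subset.antisymm (fun S hS => ?_) fun S hS => map_mem_codimGE g hS
  have := map_mem_codimGE g.symm hS
  rwa [← Submodule.map_comp, LinearEquiv.comp_coe, LinearEquiv.self_trans_symm,
    LinearEquiv.refl_toLinearMap, Submodule.map_id] at this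

variable [Finite K]

/-- Independence modulo `S` is a condition on finitely many combinations, and there are only
countably many tuples. -/
theorem measurableSet_codimGE (k : ℕ) : MeasurableSet (codimGE K k) := by
  have : codimGE K k = ⋃ v : Fin k → DirSum K, ⋂ c : Fin k → K,
      {S | c = 0} ∪ {S : Sub K | ∑ i, c i • v i ∈ S}ᶜ := by
    ext S
    simp only [codimGE, Set.mem_ofPred_eq, Set.mem_iUnion, Set.mem_iInter]
    refine exists_congr fun v => ?_
    rw [Fintype.linearIndependent_iff]
    refine forall_congr' fun c => ?_
    have : ∑ i, c i • (S.mkQ ∘ v) i = S.mkQ (∑ i, c i • v i) := by simp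
    rw [this, Submodule.mkQ_apply, Submodule.Quotient.mk_eq_zero]
    simp only [Set.mem_union, Set.mem_ofPred_eq, Set.mem_compl_iff, funext_iff, Pi.zero_apply]
    tauto
  rw [this]
  exact MeasurableSet.iUnion fun v => MeasurableSet.iInter fun c =>
    (MeasurableSet.const _).union (measurableSet_setOf_mem _).compl

theorem natCard_comap_initialInclusion_mul (N : ℕ) (S : Sub K) :
    (Nat.card (S.comap (initialInclusion K N)) : ℝ) =
      (Nat.card K : ℝ) ^ N * (Nat.card K : ℝ)⁻¹ ^ initialCodim N S := by
  have h := LinearMap.finrank_range_add_finrank_ker (S.mkQ ∘ₗ initialInclusion K N)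
  rw [LinearMap.ker_comp, Submodule.ker_mkQ, finrank_fin_fun] at h
  have hq : (Nat.card K : ℝ) ≠ 0 := by exact_mod_cast Nat.card_pos.ne'
  have hpow : (Nat.card K : ℝ) ^ N = (Nat.card K : ℝ) ^ initialCodim N S *
      (Nat.card K : ℝ) ^ finrank K (S.comap (initialInclusion K N)) := by
    rw [← pow_add, initialCodim, h]
  rw [Module.natCard_eq_pow_finrank (K := K), hpow, inv_pow]
  push_cast
  field_simp

end Codimension

/-! ### Zero-one law for invariant events -/

section Ergodicity

variable {K : Type*} [Field K] [Finite K]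

theorem IsCRS.cond {μ : Measure (Sub K)} (hμ : IsCRS μ) {A : Set (Sub K)} (hA : MeasurableSet A)
    (h0 : μ A ≠ 0)
    (hinv : ∀ g : DirSum K ≃ₗ[K] DirSum K, (fun S : Sub K => S.map g.toLinearMap) ⁻¹' A = A) :
    IsCRS (ProbabilityTheory.cond μ A) := by
  have := hμ.1
  refine ⟨ProbabilityTheory.cond_isProbabilityMeasure h0, fun g => ?_⟩
  have hg := measurable_map_equiv g
  rw [ProbabilityTheory.cond, Measure.map_smul]
  congr 1
  conv_rhs => rw [← hμ.2 g]
  rw [Measure.restrict_map hg hA, hinv]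

/-- Otherwise conditioning on `A` and on its complement would split `μ` into two distinct invariant
laws. -/
theorem IsIndecomposableCRS.measure_eq_zero_or_one {μ : Measure (Sub K)}
    (hμ : IsIndecomposableCRS μ) {A : Set (Sub K)} (hA : MeasurableSet A)
    (hinv : ∀ g : DirSum K ≃ₗ[K] DirSum K, (fun S : Sub K => S.map g.toLinearMap) ⁻¹' A = A) :
    μ A = 0 ∨ μ A = 1 := by
  have := hμ.1.1
  by_contra! h
  obtain ⟨h0, h1⟩ := h
  have hc0 : μ Aᶜ ≠ 0 := fun h => h1 ((prob_compl_eq_zero_iff hA).1 h)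
  have hlt : μ A < 1 := prob_le_one.lt_of_ne h1
  have hr : μ.real A < 1 := by
    simpa [measureReal_def] using (ENNReal.toReal_lt_toReal (by simp) (by simp)).2 hlt
  refine hμ.2 ⟨ProbabilityTheory.cond μ A, ProbabilityTheory.cond μ Aᶜ, μ.real A,
    hμ.1.cond hA h0 hinv,
    hμ.1.cond hA.compl hc0 fun g => by rw [Set.preimage_compl, hinv], ?_,
    ENNReal.toReal_pos h0 (by simp), hr, ?_⟩
  · intro h
    have h' := congrArg (fun ν : Measure (Sub K) => ν A) h
    simp only [ProbabilityTheory.cond_apply_self h0 (measure_ne_top _ _),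
      ProbabilityTheory.cond_apply hA.compl, Set.compl_inter_self, measure_empty, mul_zero] at h'
    exact one_ne_zero h'
  · have hr' : 1 - μ.real A = μ.real Aᶜ := by rw [probReal_compl_eq_one_sub hA]
    rw [hr', ofReal_measureReal, ofReal_measureReal]
    refine Measure.ext fun t _ => ?_
    conv_lhs => rw [← ProbabilityTheory.cond_add_cond_compl_eq hA μ (t := t)]
    simp [mul_comm]

end Ergodicity

/-! ### Moments of the asymptotic density -/

section Moments

theorem tendsto_natCard_linearIndependent (K : Type*) [Field K] [Finite K] (n : ℕ) :
    Tendsto (fun N : ℕ =>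
      (Nat.card {u : Fin n → Fin N → K // LinearIndependent K u} : ℝ) /
        ((Nat.card K : ℝ) ^ N) ^ n) atTop (𝓝 1) := by
  have := Fintype.ofFinite K
  have hq : 1 < (Nat.card K : ℝ) := by exact_mod_cast Finite.one_lt_card
  have hlim : Tendsto (fun N : ℕ => ∏ i : Fin n,
      (1 - (Nat.card K : ℝ) ^ (i : ℕ) * ((Nat.card K : ℝ)⁻¹) ^ N)) atTop (𝓝 1) := by
    have h0 : Tendsto (fun N : ℕ => ((Nat.card K : ℝ)⁻¹) ^ N) atTop (𝓝 0) :=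
      tendsto_pow_atTop_nhds_zero_of_lt_one (by positivity) (inv_lt_one_of_one_lt₀ hq)
    have : (1 : ℝ) = ∏ i : Fin n, (1 - (Nat.card K : ℝ) ^ (i : ℕ) * 0) := by simp
    conv => rhs; rw [this]
    exact tendsto_finsetProd _ fun i _ => (h0.const_mul _).const_sub 1
  refine hlim.congr' ?_
  filter_upwards [eventually_ge_atTop n] with N hN
  -- The count is `∏ (q^N - q^i)`, each new vector avoiding the span of the previous `i`.
  rw [card_linearIndependent (by simpa using hN), ← Nat.card_eq_fintype_card, finrank_fin_fun,
    Nat.cast_prod]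
  have : ((Nat.card K : ℝ) ^ N) ^ n = ∏ i : Fin n, (Nat.card K : ℝ) ^ N := by simp
  rw [this, ← Finset.prod_div_distrib]
  refine Finset.prod_congr rfl fun i _ => ?_
  rw [Nat.cast_sub (Nat.pow_le_pow_right Nat.card_pos (by omega))]
  push_cast
  have : (Nat.card K : ℝ) ≠ 0 := by positivity
  rw [inv_pow]
  field_simp

variable {K : Type*} [Field K] [Finite K]

open Classical in
theorem finsum_indicator_forall_mem (N n : ℕ) (S : Sub K) :
    ∑ᶠ u : Fin n → Fin N → K, Set.indicator {S : Sub K | ∀ i, initialInclusion K N (u i) ∈ S}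
      (fun _ => (1 : ℝ)) S =
    ((Nat.card K : ℝ) ^ N) ^ n * ((Nat.card K : ℝ)⁻¹ ^ initialCodim N S) ^ n := by
  have := Fintype.ofFinite K
  rw [← mul_pow, ← natCard_comap_initialInclusion_mul, finsum_eq_sum_of_fintype]
  simp only [Set.indicator_apply, Set.mem_ofPred_eq]
  rw [Finset.sum_boole, ← Fintype.card_subtype, ← Nat.card_eq_fintype_card, ← Nat.cast_pow,
    ← Nat.card_fin n]
  rw [show (Nat.card (Fin n)) = n by simp]
  congr 1
  let e : {u : Fin n → Fin N → K // ∀ i, initialInclusion K N (u i) ∈ S} ≃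
      (Fin n → S.comap (initialInclusion K N)) :=
    Equiv.subtypePiEquivPi (p := fun _ x => initialInclusion K N x ∈ S)
  rw [Nat.card_congr e, Nat.card_fun, Nat.card_fin]

theorem measurable_inv_pow_initialCodim_pow (N n : ℕ) :
    Measurable (fun S : Sub K => ((Nat.card K : ℝ)⁻¹ ^ initialCodim N S) ^ n) := by
  have hq : (Nat.card K : ℝ) ≠ 0 := by exact_mod_cast Nat.card_pos.ne'
  have := Fintype.ofFinite K
  have : (fun S : Sub K => ((Nat.card K : ℝ)⁻¹ ^ initialCodim N S) ^ n) = fun S =>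
      (((Nat.card K : ℝ) ^ N) ^ n)⁻¹ * ∑ u : Fin n → Fin N → K,
        Set.indicator {S : Sub K | ∀ i, initialInclusion K N (u i) ∈ S} (fun _ => (1 : ℝ)) S := by
    funext S
    rw [← finsum_eq_sum_of_fintype, finsum_indicator_forall_mem]
    field_simp
  rw [this]
  exact (Finset.measurable_sum _ fun u _ => measurable_const.indicator
    (measurableSet_setOf_forall_mem _)).const_mul _

theorem integral_inv_pow_initialCodim_pow (μ : Measure (Sub K)) [IsProbabilityMeasure μ] (N n : ℕ) :
    ((Nat.card K : ℝ) ^ N) ^ n * ∫ S, ((Nat.card K : ℝ)⁻¹ ^ initialCodim N S) ^ n ∂μ =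
      ∑ᶠ u : Fin n → Fin N → K, μ.real {S | ∀ i, initialInclusion K N (u i) ∈ S} := by
  have := Fintype.ofFinite K
  rw [← integral_const_mul]
  simp_rw [← finsum_indicator_forall_mem, finsum_eq_sum_of_fintype]
  rw [integral_finsetSum]
  · refine Finset.sum_congr rfl fun u _ => ?_
    rw [integral_indicator (measurableSet_setOf_forall_mem _)]
    simp
  · exact fun u _ => (integrable_const _).indicator (measurableSet_setOf_forall_mem _)

/-- The integral averages containment probabilities over all `n`-tuples of `V_N`. Independent tuples
contribute no error by homogeneity, dependent ones at most `1` each, so the bound is the proportion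
of dependent tuples. -/
theorem IsCRS.abs_integral_initialCodim_sub_le {μ : Measure (Sub K)} (hμ : IsCRS μ) {n : ℕ}
    {v : Fin n → DirSum K} (hv : LinearIndependent K v) (N : ℕ) :
    |∫ S, ((Nat.card K : ℝ)⁻¹ ^ initialCodim N S) ^ n ∂μ - μ.real {S | ∀ i, v i ∈ S}| ≤
      1 - (Nat.card {u : Fin n → Fin N → K // LinearIndependent K u} : ℝ) /
        ((Nat.card K : ℝ) ^ N) ^ n := by
  classical
  have := hμ.1
  have := Fintype.ofFinite K
  have hq : 0 < (Nat.card K : ℝ) := by exact_mod_cast Nat.card_pos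
  have hQ : 0 < ((Nat.card K : ℝ) ^ N) ^ n := by positivity
  have hcard : ((Nat.card K : ℝ) ^ N) ^ n = ∑ u : Fin n → Fin N → K, (1 : ℝ) := by
    simp [Nat.card_eq_fintype_card]
  have hI : (Nat.card {u : Fin n → Fin N → K // LinearIndependent K u} : ℝ) =
      ∑ u : Fin n → Fin N → K, if LinearIndependent K u then (1 : ℝ) else 0 := by
    rw [Finset.sum_boole, ← Fintype.card_subtype, Nat.card_eq_fintype_card]
  rw [← mul_le_mul_iff_right₀ hQ, ← abs_of_pos hQ, ← abs_mul, abs_of_pos hQ, mul_sub, mul_sub,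
    integral_inv_pow_initialCodim_pow, finsum_eq_sum_of_fintype, mul_div_cancel₀ _ hQ.ne', mul_one, hI, hcard,
    Finset.sum_mul, ← Finset.sum_sub_distrib, ← Finset.sum_sub_distrib]
  refine (Finset.abs_sum_le_sum_abs _ _).trans (Finset.sum_le_sum fun u _ => ?_)
  split_ifs with hu
  · have := hμ.measure_forall_mem_eq (hu.map' _ (LinearMap.ker_eq_bot.2
      (initialInclusion_injective N))) hv
    simp only [Function.comp_apply] at this
    simp [measureReal_def, this]
  · rw [one_mul, sub_zero, abs_le]
    constructor <;>
    linarith [measureReal_nonneg (μ := μ) (s := {S | ∀ i, initialInclusion K N (u i) ∈ S}),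
      measureReal_nonneg (μ := μ) (s := {S | ∀ i, v i ∈ S}),
      measureReal_le_one (μ := μ) (s := {S | ∀ i, initialInclusion K N (u i) ∈ S}),
      measureReal_le_one (μ := μ) (s := {S | ∀ i, v i ∈ S})]

/-- If the asymptotic density of an invariant random subspace is almost surely the constant `L`,
then it contains `n` given linearly independent vectors with probability `L ^ n`. -/
theorem IsCRS.real_forall_mem_of_tendsto {μ : Measure (Sub K)} (hμ : IsCRS μ) {L : ℝ}
    (hL : ∀ᵐ S ∂μ, Tendsto (fun N => (Nat.card K : ℝ)⁻¹ ^ initialCodim N S) atTop (𝓝 L)) {n : ℕ}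
    {v : Fin n → DirSum K} (hv : LinearIndependent K v) :
    μ.real {S | ∀ i, v i ∈ S} = L ^ n := by
  have := hμ.1
  have hq : 1 ≤ (Nat.card K : ℝ) := by exact_mod_cast Nat.card_pos
  have h1 : Tendsto (fun N => ∫ S, ((Nat.card K : ℝ)⁻¹ ^ initialCodim N S) ^ n ∂μ) atTop
      (𝓝 (L ^ n)) := by
    have := tendsto_integral_of_dominated_convergence (μ := μ) (f := fun _ => L ^ n)
      (F := fun N S => ((Nat.card K : ℝ)⁻¹ ^ initialCodim N S) ^ n) (fun _ => (1 : ℝ))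
      (fun N => (measurable_inv_pow_initialCodim_pow N n).aestronglyMeasurable) (integrable_const _)
      (fun N => ae_of_all _ fun S => ?_) (hL.mono fun S hS => hS.pow n)
    · simpa using this
    · rw [Real.norm_of_nonneg (by positivity)]
      exact pow_le_one₀ (by positivity) (pow_le_one₀ (by positivity) (inv_le_one_of_one_le₀ hq))
  have h2 : Tendsto (fun N => ∫ S, ((Nat.card K : ℝ)⁻¹ ^ initialCodim N S) ^ n ∂μ) atTop
      (𝓝 (μ.real {S | ∀ i, v i ∈ S})) := by
    rw [tendsto_iff_norm_sub_tendsto_zero]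
    refine squeeze_zero (fun _ => norm_nonneg _)
      (fun N => hμ.abs_integral_initialCodim_sub_le hv N) ?_
    simpa using (tendsto_natCard_linearIndependent K n).const_sub 1
  exact tendsto_nhds_unique h2 h1

theorem IsIndecomposableCRS.exists_ae_tendsto {μ : Measure (Sub K)} (hμ : IsIndecomposableCRS μ) :
    ∃ L : ℝ, (L = 0 ∨ ∃ κ : ℕ, L = (Nat.card K : ℝ)⁻¹ ^ κ) ∧
      ∀ᵐ S ∂μ, Tendsto (fun N => (Nat.card K : ℝ)⁻¹ ^ initialCodim N S) atTop (𝓝 L) := by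
  have := hμ.1.1
  have hq : 1 < (Nat.card K : ℝ) := by exact_mod_cast Finite.one_lt_card
  have hB := fun k => hμ.measure_eq_zero_or_one (measurableSet_codimGE k) (preimage_map_codimGE k)
  by_cases h : ∀ k, μ (codimGE K k) = 1
  · refine ⟨0, Or.inl rfl, ?_⟩
    have hae : ∀ᵐ S ∂μ, ∀ k, S ∈ codimGE K k := by
      rw [ae_all_iff]
      exact fun k => (prob_compl_eq_zero_iff (measurableSet_codimGE k)).2 (h k)
    filter_upwards [hae] with S hS
    exact (tendsto_pow_atTop_nhds_zero_of_lt_one (by positivity)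
      (inv_lt_one_of_one_lt₀ hq)).comp
      (tendsto_atTop.2 fun k => eventually_le_initialCodim (hS k))
  · push Not at h
    -- This `κ` is the almost sure codimension; it exists because `codimGE K 0` is everything.
    obtain ⟨κ, hκ, hmin⟩ : ∃ κ, μ (codimGE K κ) = 1 ∧ μ (codimGE K (κ + 1)) ≠ 1 := by
      by_contra! hcon
      obtain ⟨k, hk⟩ := h
      refine hk ?_
      clear hk
      induction k with
      | zero => simp [codimGE_zero]
      | succ k ih => exact hcon k ih
    refine ⟨_, Or.inr ⟨κ, rfl⟩, ?_⟩
    have h1 : ∀ᵐ S ∂μ, S ∈ codimGE K κ :=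
      (prob_compl_eq_zero_iff (measurableSet_codimGE κ)).2 hκ
    have h2 : ∀ᵐ S ∂μ, S ∉ codimGE K (κ + 1) :=
      measure_eq_zero_iff_ae_notMem.1 ((hB (κ + 1)).resolve_right hmin)
    filter_upwards [h1, h2] with S hS hS'
    refine tendsto_const_nhds.congr' ?_
    filter_upwards [eventually_le_initialCodim hS] with N hN
    have : ¬ κ + 1 ≤ initialCodim N S := fun h => hS' (mem_codimGE_of_le h)
    rw [show initialCodim N S = κ by omega]

end Moments

end RandomSubspace

open RandomSubspace in
theorem mainTheorem7 (K : Type*) [Field K] [Finite K]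
    (lam : MeasureTheory.Measure (RandomSubspace.Sub K))
    (hlam : RandomSubspace.IsIndecomposableCRS lam)
    (hne : lam ≠ MeasureTheory.Measure.dirac (⊥ : RandomSubspace.Sub K)) :
    ∃! κ : ℕ, RandomSubspace.kerLaw K κ = lam := by
  have := hlam.1.1
  have hq : 1 < (Nat.card K : ℝ) := by exact_mod_cast Finite.one_lt_card
  obtain ⟨L, hL, htend⟩ := hlam.exists_ae_tendsto
  have hmom := fun n (v : Fin n → DirSum K) hv =>
    hlam.1.real_forall_mem_of_tendsto htend (v := v) hv
  obtain rfl | ⟨κ, rfl⟩ := hL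
  · refine absurd (measure_ext_of_linearIndependent fun n v hv => ?_) hne
    rw [← measureReal_eq_measureReal_iff, hmom n v hv, measureReal_def,
      Measure.dirac_apply' _ (measurableSet_setOf_forall_mem v)]
    cases n with
    | zero => simp
    | succ n => simp [hv.ne_zero]
  · refine ⟨κ, measure_ext_of_linearIndependent fun n v hv => ?_, fun κ' h => ?_⟩
    · rw [← measureReal_eq_measureReal_iff, hmom n v hv, kerLaw_real_forall_mem K κ hv]
    -- The first moment `q^(-κ)` already determines `κ`.
    · have hv : LinearIndependent K (fun _ : Fin 1 => (Finsupp.single 0 1 : DirSum K)) :=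
        LinearIndependent.of_subsingleton 0 (by simp)
      have h1 := hmom 1 _ hv
      rw [← h, kerLaw_real_forall_mem K κ' hv, pow_one, pow_one] at h1
      exact pow_right_injective₀ (by positivity) (inv_lt_one_of_one_lt₀ hq).ne h1
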